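/- Let $\overline{\mathbb D}$ be the closed unit disc of $\mathbb C$, let $\overline{\mathbb D}^\infty=\{(z_j)_{j\ge1}: |z_j|\le 1 \text{ for all } j\}$ and $\mathbb T^\infty=\{(z_j)_{j\ge1}: |z_j|=1\text{ for all } j\}$. Let $\mathbb N_0^{(\infty)}$ and $\mathbb Z^{(\infty)}$ denote the sets of finitely supported sequences of nonnegative integers and of integers, and put $z^\alpha=\prod_j z_j^{\alpha_j}$ for $\alpha\in\mathbb N_0^{(\infty)}$. Let $A^+(\mathbb T^\infty)$ be the algebra of functions $f:\overline{\mathbb D}^\infty\to\mathbb C$ of the form $f(z)=\sum_{\alpha\in\mathbb N_0^{(\infty)}}a_\alpha z^\alpha$ with $\|f\|=\sum_\alpha|a_\alpha|<\infty$. Let $\varphi=(\varphi_i)_{i\ge1}:\overline{\mathbb D}^\infty\to\overline{\mathbb D}^\infty$ be a map that induces a composition operator $C_\varphi:A^+(\mathbb T^\infty)\to A^+(\mathbb T^\infty)$, $C_\varphi f=f\circ\varphi$ (that is, $f\circ\varphi\in A^+(\mathbb T^\infty)$ for every $f\in A^+(\mathbb T^\infty)$), and suppose that $\varphi(\mathbb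 T^\infty)\subseteq\mathbb T^\infty$. Then: (a) There are a matrix $A=(a_{ij})_{i,j\ge1}$ with entries in $\mathbb N_0$ and finitely supported rows, and complex numbers $\epsilon_i$ with $|\epsilon_i|=1$, such that $$\varphi_i(z)=\epsilon_i\prod_{j}z_j^{a_{ij}}\qquad\text{for all } i\ge1 \text{ and all } z\in\overline{\mathbb D}^\infty.$$ (b) For every such matrix $A$ and such numbers $\epsilon_i$, $C_\varphi$ is an isometry of $A^+(\mathbb T^\infty)$ if and only if the map $A^*:\mathbb Z^{(\infty)}\to\mathbb Z^{(\infty)}$, $(A^*\alpha)_j=\sum_i a_{ij}\alpha_i$, is injective. -/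

import Mathlib

open MeasureTheory

noncomputable section

/-- The closed polydisc `D̄^∞` in countably many variables. -/
abbrev ClosedPolydisc : Type := ℕ → Metric.closedBall (0 : ℂ) 1

/-- The infinite torus `T^∞`, as a subset of the closed polydisc. -/
def infiniteTorus : Set ClosedPolydisc := {z | ∀ j, ‖(z j : ℂ)‖ = 1}

/-- The monomial `z^α = ∏_j z_j ^ α_j`, for a finitely supported multi-index `α`. -/
def polyMonomial (α : ℕ →₀ ℕ) (z : ClosedPolydisc) : ℂ := α.prod fun j n => (z j : ℂ) ^ n

theorem polyMonomial_add (α β : ℕ →₀ ℕ) (z : ClosedPolydisc) :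
    polyMonomial (α + β) z = polyMonomial α z * polyMonomial β z :=
  Finsupp.prod_add_index' (fun _ => pow_zero _) (fun _ _ _ => pow_add _ _ _)

theorem norm_polyMonomial_le (α : ℕ →₀ ℕ) (z : ClosedPolydisc) : ‖polyMonomial α z‖ ≤ 1 := by
  unfold polyMonomial Finsupp.prod
  rw [norm_prod]
  refine Finset.prod_le_one (fun _ _ => norm_nonneg _) fun j _ => ?_
  rw [norm_pow]
  exact pow_le_one₀ (norm_nonneg _) (mem_closedBall_zero_iff.1 (z j).2)

/-- `f` is the sum, on the closed polydisc, of the absolutely convergent Taylor series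
`∑_α a_α z^α`. -/
def HasWienerExpansion (a : (ℕ →₀ ℕ) → ℂ) (f : ClosedPolydisc → ℂ) : Prop :=
  Summable (fun α => ‖a α‖) ∧ ∀ z, HasSum (fun α => a α * polyMonomial α z) (f z)

namespace HasWienerExpansion

variable {a b : (ℕ →₀ ℕ) → ℂ} {f g : ClosedPolydisc → ℂ}

theorem add (hf : HasWienerExpansion a f) (hg : HasWienerExpansion b g) :
    HasWienerExpansion (a + b) (f + g) := by
  refine ⟨(hf.1.add hg.1).of_nonneg_of_le (fun _ => norm_nonneg _) fun _ => norm_add_le _ _,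
    fun z => ?_⟩
  simpa [add_mul] using (hf.2 z).add (hg.2 z)

theorem smul (c : ℂ) (hf : HasWienerExpansion a f) : HasWienerExpansion (c • a) (c • f) := by
  refine ⟨by simpa using hf.1.mul_left ‖c‖, fun z => ?_⟩
  simpa [mul_assoc] using (hf.2 z).mul_left c

theorem const (c : ℂ) : HasWienerExpansion (Pi.single 0 c) (fun _ => c) := by
  refine ⟨summable_of_ne_finset_zero (s := {0}) fun α hα => by simp_all, fun z => ?_⟩
  convert hasSum_single (0 : ℕ →₀ ℕ) (fun α hα => ?_) using 1
  · simp [polyMonomial]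
  · simp [hα]

theorem summable_mul_monomial (hf : HasWienerExpansion a f) (z : ClosedPolydisc) :
    Summable fun α => ‖a α * polyMonomial α z‖ :=
  hf.1.of_nonneg_of_le (fun _ => norm_nonneg _) fun α => by
    rw [norm_mul]; exact mul_le_of_le_one_right (norm_nonneg _) (norm_polyMonomial_le α z)

theorem mul (hf : HasWienerExpansion a f) (hg : HasWienerExpansion b g) :
    HasWienerExpansion
      (fun α => ∑ p ∈ Finset.HasAntidiagonal.antidiagonal α, a p.1 * b p.2) (f * g) := by
  have key : ∀ z, ∀ α : ℕ →₀ ℕ,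
      (∑ p ∈ Finset.HasAntidiagonal.antidiagonal α, a p.1 * b p.2) * polyMonomial α z
        = ∑ p ∈ Finset.HasAntidiagonal.antidiagonal α,
          (a p.1 * polyMonomial p.1 z) * (b p.2 * polyMonomial p.2 z) := by
    intro z α
    rw [Finset.sum_mul]
    refine Finset.sum_congr rfl fun p hp => ?_
    rw [← Finset.HasAntidiagonal.mem_antidiagonal.1 hp, polyMonomial_add]
    ring
  have h0 : Summable fun p : (ℕ →₀ ℕ) × (ℕ →₀ ℕ) => ‖a p.1‖ * ‖b p.2‖ :=
    Summable.mul_of_nonneg hf.1 hg.1 (fun _ => norm_nonneg _) (fun _ => norm_nonneg _)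
  have hn := summable_sum_mul_antidiagonal_of_summable_mul
    (f := fun α => ‖a α‖) (g := fun β => ‖b β‖) h0
  have h1 : ∀ α : ℕ →₀ ℕ,
      ‖∑ p ∈ Finset.HasAntidiagonal.antidiagonal α, a p.1 * b p.2‖
        ≤ ∑ p ∈ Finset.HasAntidiagonal.antidiagonal α, ‖a p.1‖ * ‖b p.2‖ := by
    intro α
    refine (norm_sum_le _ _).trans (le_of_eq ?_)
    exact Finset.sum_congr rfl fun p _ => norm_mul _ _
  refine ⟨Summable.of_nonneg_of_le (fun _ => norm_nonneg _) h1 hn, fun z => ?_⟩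
  have hs := summable_mul_of_summable_norm (hf.summable_mul_monomial z)
    (hg.summable_mul_monomial z)
  have h2 := (hf.2 z).summable.tsum_mul_tsum_eq_tsum_sum_antidiagonal (hg.2 z).summable hs
  have h3 := (summable_sum_mul_antidiagonal_of_summable_mul
    (f := fun α => a α * polyMonomial α z) (g := fun β => b β * polyMonomial β z) hs).hasSum
  rw [← h2, (hf.2 z).tsum_eq, (hg.2 z).tsum_eq] at h3
  simp only [key]
  exact h3

/-- A point of the compact group `Circle^ℕ`, seen in the closed polydisc. -/
def torusPoint (w : ℕ → Circle) : ClosedPolydisc := fun j =>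
  ⟨(w j : ℂ), mem_closedBall_zero_iff.2 (Circle.norm_coe (w j)).le⟩

theorem polyMonomial_mul_point (α : ℕ →₀ ℕ) (v w : ℕ → Circle) :
    polyMonomial α (torusPoint (v * w))
      = polyMonomial α (torusPoint v) * polyMonomial α (torusPoint w) := by
  simp [polyMonomial, torusPoint, Finsupp.prod, mul_pow, Finset.prod_mul_distrib]

theorem norm_polyMonomial_point (α : ℕ →₀ ℕ) (w : ℕ → Circle) :
    ‖polyMonomial α (torusPoint w)‖ = 1 := by
  simp [polyMonomial, torusPoint, Finsupp.prod, Circle.norm_coe]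

theorem continuous_polyMonomial_point (α : ℕ →₀ ℕ) :
    Continuous fun w => polyMonomial α (torusPoint w) := by
  unfold polyMonomial torusPoint Finsupp.prod
  fun_prop

theorem exists_point_ne {α β : ℕ →₀ ℕ} (h : α ≠ β) :
    ∃ w, polyMonomial α (torusPoint w) ≠ polyMonomial β (torusPoint w) := by
  obtain ⟨j, hj⟩ := DFunLike.ne_iff.1 h
  have ev : ∀ γ : ℕ →₀ ℕ, ∀ u : Circle,
      polyMonomial γ (torusPoint (Function.update 1 j u)) = (u : ℂ) ^ γ j := by
    intro γ u
    unfold polyMonomial torusPoint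
    rw [Finsupp.prod_of_support_subset _ (Finset.subset_insert j _) _ (by simp),
      Finset.prod_eq_single j] <;> simp +contextual [Function.update_of_ne]
  refine ⟨Function.update 1 j (Circle.exp 1), ?_⟩
  rw [ev, ev, Circle.coe_exp, ← Complex.exp_nat_mul, ← Complex.exp_nat_mul]
  intro H
  obtain ⟨n, hn⟩ := Complex.exp_eq_exp_iff_exists_int.1 H
  have hr : (α j : ℝ) = β j + n * (2 * Real.pi) := by
    have := congrArg Complex.im hn
    simpa using this
  rcases eq_or_ne n 0 with rfl | hn0
  · apply hj; exact_mod_cast (by simpa using hr : (α j : ℝ) = β j)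
  · refine (irrational_pi.ratCast_mul (q := 2 * n) (by exact_mod_cast (by omega))).ne_int
      ((α j : ℤ) - β j) ?_
    push_cast
    linarith

/-- An absolutely convergent Taylor series is determined by its sum. -/
theorem coeff_unique (ha : HasWienerExpansion a f) (hb : HasWienerExpansion b f) : a = b := by
  have main : ∀ (c : (ℕ →₀ ℕ) → ℂ), HasWienerExpansion c 0 → c = 0 := by
    intro c hc
    funext α
    let _ : MeasurableSpace (ℕ → Circle) := borel _
    have _ : BorelSpace (ℕ → Circle) := ⟨rfl⟩
    let μ : Measure (ℕ → Circle) := Measure.haar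
    let χ : (ℕ →₀ ℕ) → (ℕ → Circle) → ℂ := fun β w => polyMonomial β (torusPoint w)
    have hχ : ∀ β, Continuous (χ β) := continuous_polyMonomial_point
    have hint : ∀ F : (ℕ → Circle) → ℂ, Continuous F → Integrable F μ := fun F hF =>
      hF.integrable_of_hasCompactSupport (HasCompactSupport.of_compactSpace F)
    have hnχ : ∀ β w, ‖χ β w‖ = 1 := norm_polyMonomial_point
    have horth : ∀ β, β ≠ α → ∫ w, χ β w * (starRingEnd ℂ) (χ α w) ∂μ = 0 := by
      intro β hβ
      obtain ⟨v, hv⟩ := exists_point_ne hβ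
      have hinv := integral_mul_left_eq_self (μ := μ)
        (fun w => χ β w * (starRingEnd ℂ) (χ α w)) v
      have hmul : ∀ w, χ β (v * w) * (starRingEnd ℂ) (χ α (v * w))
          = (χ β v * (starRingEnd ℂ) (χ α v)) * (χ β w * (starRingEnd ℂ) (χ α w)) := by
        intro w
        simp only [χ, polyMonomial_mul_point, map_mul]
        ring
      simp only [hmul] at hinv
      rw [integral_const_mul] at hinv
      by_contra hne
      have h1 := mul_right_cancel₀ hne (hinv.trans (one_mul _).symm)
      apply hv
      have h2 : (starRingEnd ℂ) (χ α v) * χ α v = 1 := by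
        rw [mul_comm, Complex.mul_conj, Complex.normSq_eq_norm_sq, hnχ]; simp
      calc χ β v = χ β v * ((starRingEnd ℂ) (χ α v) * χ α v) := by rw [h2, mul_one]
        _ = χ α v := by rw [← mul_assoc, h1, one_mul]
    have hcont : ∀ β, Continuous fun w => c β * χ β w * (starRingEnd ℂ) (χ α w) := fun β =>
      (continuous_const.mul (hχ β)).mul (Complex.continuous_conj.comp (hχ α))
    have hsum := hasSum_integral_of_summable_integral_norm (μ := μ)
      (F := fun β w => c β * χ β w * (starRingEnd ℂ) (χ α w))
      (fun β => hint _ (hcont β)) (by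
        simp only [norm_mul, hnχ, RCLike.norm_conj, mul_one, integral_const, smul_eq_mul]
        exact hc.1.mul_left _)
    have hz : ∀ w, ∑' β, c β * χ β w * (starRingEnd ℂ) (χ α w) = 0 := fun w => by
      rw [tsum_mul_right, (hc.2 (torusPoint w)).tsum_eq]; simp
    simp only [hz, integral_zero] at hsum
    have hsingle : HasSum (fun β => ∫ w, c β * χ β w * (starRingEnd ℂ) (χ α w) ∂μ)
        (∫ w, c α * χ α w * (starRingEnd ℂ) (χ α w) ∂μ) := by
      refine hasSum_single α fun β hβ => ?_
      simp only [mul_assoc]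
      rw [integral_const_mul, horth β hβ, mul_zero]
    have h0 := hsingle.unique hsum
    have h3 : ∀ w, c α * χ α w * (starRingEnd ℂ) (χ α w) = c α := fun w => by
      rw [mul_assoc, Complex.mul_conj, Complex.normSq_eq_norm_sq, hnχ]; simp
    simp only [h3, integral_const] at h0
    rcases smul_eq_zero.1 h0 with h | h
    · exact absurd h measureReal_univ_pos.ne'
    · exact h
  have := main (a + (-1 : ℂ) • b) (by simpa using ha.add (hb.smul (-1)))
  funext α
  have := congrFun this α
  simpa [← sub_eq_add_neg, sub_eq_zero] using this

end HasWienerExpansion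

/-- The functions on the closed polydisc that are sums of absolutely convergent Taylor series. -/
def wienerSubalgebra : Subalgebra ℂ (ClosedPolydisc → ℂ) where
  carrier := {f | ∃ a, HasWienerExpansion a f}
  mul_mem' := fun ⟨_, ha⟩ ⟨_, hb⟩ => ⟨_, HasWienerExpansion.mul ha hb⟩
  add_mem' := fun ⟨_, ha⟩ ⟨_, hb⟩ => ⟨_, HasWienerExpansion.add ha hb⟩
  algebraMap_mem' := fun c => ⟨_, HasWienerExpansion.const c⟩

/-- The Wiener algebra `A⁺(T^∞)`; a type of its own, so that it carries the norm `∑_α |a_α|` and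
not the topology of pointwise convergence. -/
def WienerAlgebra : Type := wienerSubalgebra

namespace WienerAlgebra

instance : CommRing WienerAlgebra := inferInstanceAs (CommRing wienerSubalgebra)

instance : Algebra ℂ WienerAlgebra := inferInstanceAs (Algebra ℂ wienerSubalgebra)

/-- The function on the closed polydisc underlying an element of the Wiener algebra. -/
def toFun (f : WienerAlgebra) : ClosedPolydisc → ℂ := Subtype.val f

theorem exists_expansion (f : WienerAlgebra) : ∃ a, HasWienerExpansion a f.toFun :=
  Subtype.property f

/-- The Taylor coefficients of an element of the Wiener algebra. -/
def coeff (f : WienerAlgebra) : (ℕ →₀ ℕ) → ℂ := Classical.choose f.exists_expansion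

theorem hasWienerExpansion (f : WienerAlgebra) : HasWienerExpansion f.coeff f.toFun :=
  Classical.choose_spec f.exists_expansion

theorem coeff_eq (f : WienerAlgebra) {a : (ℕ →₀ ℕ) → ℂ} (h : HasWienerExpansion a f.toFun) :
    f.coeff = a :=
  f.hasWienerExpansion.coeff_unique h

theorem coeff_add (f g : WienerAlgebra) : (f + g).coeff = f.coeff + g.coeff :=
  coeff_eq _ (f.hasWienerExpansion.add g.hasWienerExpansion)

theorem coeff_smul (c : ℂ) (f : WienerAlgebra) : (c • f).coeff = c • f.coeff :=
  coeff_eq _ (f.hasWienerExpansion.smul c)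

/-- The norm `‖f‖ = ∑_α |a_α|` of `f = ∑_α a_α z^α`. -/
instance : Norm WienerAlgebra := ⟨fun f => ∑' α, ‖f.coeff α‖⟩

theorem norm_def (f : WienerAlgebra) : ‖f‖ = ∑' α, ‖f.coeff α‖ := rfl

theorem normedSpaceCore : NormedSpace.Core ℂ WienerAlgebra where
  norm_nonneg f := tsum_nonneg fun _ => norm_nonneg _
  norm_smul c f := by simp [norm_def, coeff_smul, tsum_mul_left]
  norm_triangle f g := by
    have hf := f.hasWienerExpansion.1
    have hg := g.hasWienerExpansion.1
    rw [norm_def, norm_def, norm_def, ← hf.tsum_add hg]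
    exact (f + g).hasWienerExpansion.1.tsum_le_tsum
      (fun α => by rw [coeff_add]; exact norm_add_le _ _) (hf.add hg)
  norm_eq_zero_iff f := by
    have hf := f.hasWienerExpansion
    constructor
    · intro h
      have h1 := (hasSum_zero_iff_of_nonneg fun _ => norm_nonneg _).1 
        (by rw [← h]; exact hf.1.hasSum)
      refine Subtype.ext (funext fun z => (hf.2 z).unique ?_)
      have h2 : ∀ α, f.coeff α = 0 := fun α => norm_eq_zero.1 (congrFun h1 α)
      simp only [h2, zero_mul]
      exact hasSum_zero
    · rintro rfl
      have : (0 : WienerAlgebra).coeff = 0 := by simpa using coeff_smul 0 0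
      simp [norm_def, this]

instance : NormedAddCommGroup WienerAlgebra := NormedAddCommGroup.ofCore normedSpaceCore

instance : NormedSpace ℂ WienerAlgebra := NormedSpace.ofCore normedSpaceCore

end WienerAlgebra

/-- The self-map `φ` of the closed polydisc induces a composition operator on `A⁺(T^∞)`:
`f ∘ φ` belongs to `A⁺(T^∞)` for every `f` in `A⁺(T^∞)`. -/
def InducesCompositionOperator (φ : ClosedPolydisc → ClosedPolydisc) : Prop :=
  ∀ f ∈ wienerSubalgebra, f ∘ φ ∈ wienerSubalgebra

/-- The composition operator `C_φ : A⁺(T^∞) → A⁺(T^∞)`, `f ↦ f ∘ φ`. -/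
def compositionOperator (φ : ClosedPolydisc → ClosedPolydisc)
    (hφ : InducesCompositionOperator φ) : WienerAlgebra →ₗ[ℂ] WienerAlgebra where
  toFun f := ⟨f.toFun ∘ φ, hφ f.toFun (Subtype.property f)⟩
  map_add' _ _ := rfl
  map_smul' _ _ := rfl

theorem compositionOperator_toFun (φ : ClosedPolydisc → ClosedPolydisc)
    (hφ : InducesCompositionOperator φ) (f : WienerAlgebra) (z : ClosedPolydisc) :
    (compositionOperator φ hφ f).toFun z = f.toFun (φ z) := rfl

/-- `φ_i(z) = ε_i ∏_j z_j ^ a_ij` on the closed polydisc with complex signs `ε_i`, where `A i` is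
the `i`-th row, finitely supported, of the matrix `(a_ij)` of nonnegative integers. -/
def HasMonomialForm (φ : ClosedPolydisc → ClosedPolydisc) (A : ℕ → ℕ →₀ ℕ) (ε : ℕ → ℂ) : Prop :=
  (∀ i, ‖ε i‖ = 1) ∧ ∀ z i, (φ z i : ℂ) = ε i * (A i).prod fun j n => (z j : ℂ) ^ n

/-- The transpose of a row-finite matrix `A = (a_ij)` acting on finitely supported integer
sequences: `(A* α)_j = ∑_i a_ij α_i`. -/
def transposeAction (A : ℕ → ℕ →₀ ℕ) (α : ℕ →₀ ℤ) : ℕ →₀ ℤ :=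
  α.sum fun i n => n • (A i).mapRange (fun k : ℕ => (k : ℤ)) Nat.cast_zero

theorem transposeAction_apply (A : ℕ → ℕ →₀ ℕ) (α : ℕ →₀ ℤ) (j : ℕ) :
    transposeAction A α j = ∑ i ∈ α.support, (A i j : ℤ) * α i := by
  simp [transposeAction, Finsupp.sum, Finsupp.finsetSum_apply, mul_comm]

end
/-
`C_φ` is bounded by the closed graph theorem, so the powers `φ_i ^ n = C_φ (z_i ^ n)` are bounded in
the Wiener norm, and `φ_i` is unimodular on the compact connected group `T^∞`. By Beurling and
Helson, such a function `f` has only one non-zero coefficient. Indeed, a unimodular `v` with powers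
of norm at most `C` either is constant or has only null level sets: the averages of the powers of
`z̄ v` converge to the indicator of `{v = z}`, which is therefore almost everywhere equal to an
absolutely convergent series of characters, hence to a continuous idempotent. Apply this to
`v_τ (x) = f (x τ) / f x`. If `v_τ` is constant, all characters occurring in `f` agree at `τ`, which
by the same dichotomy happens only for almost no `τ` when two of them are distinct. Otherwise, the
averages over `n` of `|∫ v_τ ^ n|²` tend to zero by Wiener's lemma. But
`∫ |∫ v_τ ^ n|² dτ` is the sum of the fourth powers of the coefficients of `f ^ n`, whose squares
add up to `1` and whose `ℓ¹`-norm is at most `C`, so it is at least `1 / C²`.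

For monomial `φ`, `C_φ` sends each `z^α` to a unimodular multiple of `z^(A* α)`, so it is isometric
precisely when `A*` is injective on `ℕ₀^(∞)`, or equivalently on the group `ℤ^(∞)` of differences.
-/

noncomputable section

open Filter Topology ComplexConjugate

section Averages

theorem tendsto_average_pow {z : ℂ} (hz : ‖z‖ ≤ 1) :
    Tendsto (fun N : ℕ => (N : ℂ)⁻¹ * ∑ n ∈ Finset.range N, z ^ n) atTop
      (𝓝 (if z = 1 then 1 else 0)) := by
  split_ifs with h
  · refine tendsto_const_nhds.congr' ?_
    filter_upwards [eventually_ne_atTop 0] with N hN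
    simp [h, hN]
  · refine squeeze_zero_norm (a := fun N : ℕ => (2 / ‖z - 1‖) * (N : ℝ)⁻¹) (fun N => ?_) ?_
    · rw [geom_sum_eq h, norm_mul, norm_div, norm_inv, Complex.norm_natCast, mul_comm]
      gcongr
      calc ‖z ^ N - 1‖ ≤ ‖z ^ N‖ + ‖(1 : ℂ)‖ := norm_sub_le _ _
        _ ≤ 2 := by rw [norm_pow, norm_one]; linarith [pow_le_one₀ (n := N) (norm_nonneg z) hz]
    · simpa using tendsto_natCast_atTop_atTop.inv_tendsto_atTop.const_mul (2 / ‖z - 1‖)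

theorem norm_average_le {E : Type*} [SeminormedAddCommGroup E] [NormedSpace ℝ E] {f : ℕ → E}
    {B : ℝ} (hB : 0 ≤ B) (hf : ∀ n, ‖f n‖ ≤ B) (N : ℕ) :
    ‖(N : ℝ)⁻¹ • ∑ n ∈ Finset.range N, f n‖ ≤ B := by
  rcases N.eq_zero_or_pos with rfl | hN
  · simpa using hB
  · have hN' : (0 : ℝ) < N := Nat.cast_pos.2 hN
    rw [norm_smul, norm_inv, RCLike.norm_natCast, inv_mul_le_iff₀ hN']
    calc ‖∑ n ∈ Finset.range N, f n‖ ≤ ∑ n ∈ Finset.range N, ‖f n‖ := norm_sum_le _ _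
      _ ≤ N * B := by
        simpa using Finset.sum_le_card_nsmul (Finset.range N) (‖f ·‖) B fun n _ => hf n

variable {Ω : Type*} [MeasurableSpace Ω] {ν : Measure Ω} [IsFiniteMeasure ν]

theorem tendsto_average_integral_pow {u : Ω → ℂ} (hu : Measurable u) (h1 : ∀ x, ‖u x‖ ≤ 1)
    (hne : ∀ᵐ x ∂ν, u x ≠ 1) :
    Tendsto (fun N : ℕ => (N : ℝ)⁻¹ • ∑ n ∈ Finset.range N, ∫ x, u x ^ n ∂ν) atTop (𝓝 0) := by
  have hpow : ∀ n x, ‖u x ^ n‖ ≤ 1 := fun n x => by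
    rw [norm_pow]; exact pow_le_one₀ (norm_nonneg _) (h1 x)
  have hint : ∀ n, Integrable (fun x => u x ^ n) ν := fun n =>
    .of_bound (hu.pow_const n).aestronglyMeasurable 1 (.of_forall (hpow n))
  have hlim : Tendsto (fun N : ℕ => ∫ x, (N : ℝ)⁻¹ • ∑ n ∈ Finset.range N, u x ^ n ∂ν) atTop
      (𝓝 (∫ _, 0 ∂ν)) := by
    refine tendsto_integral_of_dominated_convergence (fun _ => 1)
      (fun N => ((Finset.measurable_fun_sum _ fun n _ => hu.pow_const n).const_smul
        (N : ℝ)⁻¹).aestronglyMeasurable)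
      (integrable_const 1)
      (fun N => .of_forall fun x => norm_average_le zero_le_one (hpow · x) N) ?_
    filter_upwards [hne] with x hx
    simpa [hx] using tendsto_average_pow (h1 x)
  simpa [integral_const_mul, integral_finsetSum _ fun n _ => hint n] using hlim

/-- Wiener's lemma for the moments of a diffuse distribution on the disc; the square makes the
`n`-th moment the integral of an `n`-th power on the product space. -/
theorem tendsto_average_norm_integral_pow_sq {v : Ω → ℂ} (hv : Measurable v)
    (h1 : ∀ x, ‖v x‖ ≤ 1) (hlevel : ∀ z, ν (v ⁻¹' {z}) = 0) :
    Tendsto (fun N : ℕ => (N : ℝ)⁻¹ • ∑ n ∈ Finset.range N, ‖∫ x, v x ^ n ∂ν‖ ^ 2) atTop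
      (𝓝 0) := by
  let u : Ω × Ω → ℂ := fun p => conj (v p.1) * v p.2
  have hu : Measurable u := by fun_prop
  have hne : ∀ᵐ p ∂ν.prod ν, u p ≠ 1 := by
    refine (Measure.ae_prod_iff_ae_ae (measurableSet_eq_fun hu measurable_const).compl).2
      (.of_forall fun x => measure_mono_null (fun y hy => ?_) (hlevel (conj (v x))⁻¹))
    exact eq_inv_of_mul_eq_one_right (not_not.1 hy)
  have hmom : ∀ n, ∫ p, u p ^ n ∂ν.prod ν = ((‖∫ x, v x ^ n ∂ν‖ ^ 2 : ℝ) : ℂ) := fun n => by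
    simp only [u, mul_pow, ← map_pow]
    rw [integral_prod_mul (fun x => conj (v x ^ n)) fun x => v x ^ n, integral_conj,
      Complex.conj_mul', Complex.ofReal_pow]
  have := tendsto_average_integral_pow hu
    (fun p => by simpa [u] using mul_le_one₀ (h1 p.1) (norm_nonneg _) (h1 p.2)) hne
  rw [← tendsto_ofReal_iff]
  simpa [hmom] using this

end Averages

section CharacterExpansions

theorem integrable_conj {X : Type*} [MeasurableSpace X] {μ : Measure X} {w : X → ℂ}
    (hw : Integrable w μ) : Integrable (fun x => conj (w x)) μ :=
  Complex.conjCLE.integrable_comp_iff.2 hw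

variable {G : Type*} [Group G] [TopologicalSpace G]

theorem continuous_character (χ : G →ₜ* Circle) : Continuous fun x => (χ x : ℂ) :=
  continuous_subtype_val.comp (map_continuous χ)

theorem norm_mul_character (a : ℂ) (χ : G →ₜ* Circle) (x : G) : ‖a * χ x‖ = ‖a‖ := by
  rw [norm_mul, Circle.norm_coe, mul_one]

section Orthogonality

variable [MeasurableSpace G] {μ : Measure G}

theorem integrable_character_mul [OpensMeasurableSpace G] (χ : G →ₜ* Circle) {w : G → ℂ}
    (hw : Integrable w μ) : Integrable (fun x => χ x * w x) μ :=
  hw.bdd_mul (continuous_character χ).aestronglyMeasurable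
    (.of_forall fun x => (Circle.norm_coe (χ x)).le)

theorem integrable_character [OpensMeasurableSpace G] [IsFiniteMeasure μ] (χ : G →ₜ* Circle) :
    Integrable (fun x => (χ x : ℂ)) μ := by
  simpa using integrable_character_mul χ (integrable_const (1 : ℂ))

variable [MeasurableMul G] [μ.IsMulLeftInvariant]

theorem integral_character_eq_zero {χ : G →ₜ* Circle} (hχ : χ ≠ 1) : ∫ x, (χ x : ℂ) ∂μ = 0 := by
  obtain ⟨v, hv⟩ := DFunLike.ne_iff.1 hχ
  have hinv : (χ v : ℂ) * ∫ x, (χ x : ℂ) ∂μ = ∫ x, (χ x : ℂ) ∂μ := by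
    rw [← integral_const_mul, ← integral_mul_left_eq_self (fun x => (χ x : ℂ)) v]
    simp
  exact (mul_left_eq_self₀.1 hinv).resolve_left fun h => hv (Circle.ext h)

theorem integral_character_mul_conj_of_ne {χ ψ : G →ₜ* Circle} (h : χ ≠ ψ) :
    ∫ x, (χ x : ℂ) * conj (ψ x : ℂ) ∂μ = 0 := by
  rw [← integral_character_eq_zero (μ := μ) (mt mul_inv_eq_one.1 h)]
  refine integral_congr_ae (.of_forall fun x => ?_)
  exact congrArg ((χ x : ℂ) * ·) (Circle.coe_inv_eq_conj (ψ x)).symm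

end Orthogonality

/-- `F` is the sum of the absolutely convergent series `∑_χ c_χ χ` over the continuous unitary
characters of `G`. -/
def HasCharacterExpansion (c : (G →ₜ* Circle) → ℂ) (F : G → ℂ) : Prop :=
  Summable (fun χ => ‖c χ‖) ∧ ∀ x, HasSum (fun χ => c χ * χ x) (F x)

namespace HasCharacterExpansion

variable {c : (G →ₜ* Circle) → ℂ} {F : G → ℂ}

theorem of_summable (hc : Summable fun χ => ‖c χ‖) :
    HasCharacterExpansion c fun x => ∑' χ, c χ * χ x :=
  ⟨hc, fun x => (Summable.of_norm (by simpa only [norm_mul_character])).hasSum⟩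

theorem continuous (h : HasCharacterExpansion c F) : Continuous F := by
  rw [← funext fun x => (h.2 x).tsum_eq]
  exact continuous_tsum (fun χ => continuous_const.mul (continuous_character χ)) h.1
    fun χ x => (norm_mul_character _ χ x).le

theorem norm_le (h : HasCharacterExpansion c F) (x : G) : ‖F x‖ ≤ ∑' χ, ‖c χ‖ := by
  rw [← (h.2 x).tsum_eq]
  exact tsum_of_norm_bounded h.1.hasSum fun χ => (norm_mul_character _ χ x).le

theorem mul_right_translate (h : HasCharacterExpansion c F) (τ : G) :
    HasCharacterExpansion (fun χ => c χ * χ τ) fun x => F (x * τ) :=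
  ⟨by simpa only [norm_mul_character] using h.1, fun x => by
    simpa [mul_assoc, mul_left_comm, mul_comm] using h.2 (x * τ)⟩

section Integration

variable [MeasurableSpace G] [OpensMeasurableSpace G] {μ : Measure G}

theorem integrable [IsFiniteMeasure μ] (h : HasCharacterExpansion c F) : Integrable F μ :=
  .of_bound h.continuous.aestronglyMeasurable _ (.of_forall h.norm_le)

theorem hasSum_integral_mul (h : HasCharacterExpansion c F) {w : G → ℂ} (hw : Integrable w μ) :
    HasSum (fun χ => c χ * ∫ x, χ x * w x ∂μ) (∫ x, F x * w x ∂μ) := by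
  have hcount : Countable c.support := h.1.of_norm.countable_support
  have restrict : ∀ (e : (G →ₜ* Circle) → ℂ) (s : ℂ),
      HasSum (fun χ : c.support => c χ * e χ) s ↔ HasSum (fun χ => c χ * e χ) s := fun e _ =>
    hasSum_subtype_iff_of_support_subset (f := fun χ => c χ * e χ)
      (Function.support_mul_subset_left _ _)
  have hsum : ∀ x, HasSum (fun χ : c.support => c χ * (χ.1 x * w x)) (F x * w x) := fun x =>
    (restrict (fun χ => χ x * w x) _).2 (by simpa only [mul_assoc] using (h.2 x).mul_right (w x))
  have hint := hasSum_integral_of_summable_integral_norm (μ := μ)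
    (F := fun (χ : c.support) x => c χ * (χ.1 x * w x))
    (fun χ => (integrable_character_mul χ.1 hw).const_mul _) (by
      simp only [norm_mul, Circle.norm_coe, one_mul, integral_const_mul]
      exact (h.1.subtype _).mul_right _)
  simp only [integral_const_mul, fun x => (hsum x).tsum_eq] at hint
  exact (restrict (fun χ => ∫ x, χ x * w x ∂μ) _).1 hint

theorem integral_mul_conj_eq_zero {w : G → ℂ}
    (h : HasCharacterExpansion c F) (hw : Integrable w μ)
    (horth : ∀ χ : G →ₜ* Circle, ∫ x, w x * conj (χ x : ℂ) ∂μ = 0) :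
    ∫ x, F x * conj (w x) ∂μ = 0 := by
  have hconj : ∀ χ : G →ₜ* Circle, ∫ x, (χ x : ℂ) * conj (w x) ∂μ = 0 := fun χ => by
    rw [← map_zero (starRingEnd ℂ), ← horth χ, ← integral_conj]
    simp only [map_mul, Complex.conj_conj, mul_comm]
  simpa [hconj] using (h.hasSum_integral_mul (integrable_conj hw)).tsum_eq.symm

variable [IsProbabilityMeasure μ] [MeasurableMul G] [μ.IsMulLeftInvariant]

theorem integral_mul_conj_character (h : HasCharacterExpansion c F) (ψ : G →ₜ* Circle) :
    ∫ x, F x * conj (ψ x : ℂ) ∂μ = c ψ := by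
  refine (h.hasSum_integral_mul (integrable_conj (integrable_character ψ))).unique ?_
  convert hasSum_single ψ fun χ hχ => ?_
  · simp [Complex.mul_conj', Circle.norm_coe]
  · rw [integral_character_mul_conj_of_ne hχ, mul_zero]

theorem autocorrelation (h : HasCharacterExpansion c F) :
    HasCharacterExpansion (fun χ => ((‖c χ‖ ^ 2 : ℝ) : ℂ))
      fun τ => ∫ x, F (x * τ) * conj (F x) ∂μ := by
  have hcoeff : ∀ χ : G →ₜ* Circle, ∫ x, (χ x : ℂ) * conj (F x) ∂μ = conj (c χ) := fun χ => by
    rw [← h.integral_mul_conj_character (μ := μ) χ, ← integral_conj]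
    simp [mul_comm]
  have hsum : ∀ τ, HasSum (fun χ => ((‖c χ‖ ^ 2 : ℝ) : ℂ) * χ τ)
      (∫ x, F (x * τ) * conj (F x) ∂μ) := fun τ => by
    convert (h.mul_right_translate τ).hasSum_integral_mul (μ := μ)
      (integrable_conj h.integrable) using 2 with χ
    rw [hcoeff, mul_right_comm, Complex.mul_conj', Complex.ofReal_pow]
  exact ⟨by simpa using (hsum 1).summable.norm, hsum⟩

theorem hasSum_norm_coeff_sq (h : HasCharacterExpansion c F) :
    HasSum (fun χ => ‖c χ‖ ^ 2) (∫ x, ‖F x‖ ^ 2 ∂μ) := by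
  rw [← Complex.hasSum_ofReal, ← integral_complex_ofReal]
  simpa [Complex.mul_conj'] using (h.autocorrelation (μ := μ)).2 1

/-- Summing `t (C t - 1)² (C t + 2) ≥ 0` over `t = ‖c χ‖` compares the quadratic, quartic and
linear sums of the coefficients. -/
theorem one_le_mul_integral_norm_autocorrelation_sq (h : HasCharacterExpansion c F)
    (hF : ∀ x, ‖F x‖ = 1) {C : ℝ} (hC : ∑' χ, ‖c χ‖ ≤ C) :
    1 ≤ C ^ 2 * ∫ τ, ‖∫ x, F (x * τ) * conj (F x) ∂μ‖ ^ 2 ∂μ := by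
  have h2 : HasSum (fun χ => ‖c χ‖ ^ 2) 1 := by
    simpa [hF] using h.hasSum_norm_coeff_sq (μ := μ)
  have h4 : HasSum (fun χ => ‖c χ‖ ^ 4) (∫ τ, ‖∫ x, F (x * τ) * conj (F x) ∂μ‖ ^ 2 ∂μ) := by
    simpa [← pow_mul] using (h.autocorrelation (μ := μ)).hasSum_norm_coeff_sq (μ := μ)
  set K := ∫ τ, ‖∫ x, F (x * τ) * conj (F x) ∂μ‖ ^ 2 ∂μ
  have hC1 : 1 ≤ C := (hF 1).symm.le.trans ((h.norm_le 1).trans hC)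
  have hsum : HasSum (fun χ => ‖c χ‖ * (C * ‖c χ‖ - 1) ^ 2 * (C * ‖c χ‖ + 2))
      (C ^ 3 * K - 3 * C * 1 + 2 * ∑' χ, ‖c χ‖) := by
    refine (((h4.mul_left (C ^ 3)).sub (h2.mul_left (3 * C))).add
      (h.1.hasSum.mul_left 2)).congr_fun fun χ => ?_
    ring
  have hnonneg := hsum.nonneg fun χ => by positivity
  nlinarith

end Integration

end HasCharacterExpansion

end CharacterExpansions

section CharacterNorm

variable {G : Type*} [Group G] [TopologicalSpace G]

/-- `F` is an absolutely convergent series of characters whose coefficients have `ℓ¹`-norm at most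
`C`. -/
def HasCharacterNormLE (F : G → ℂ) (C : ℝ) : Prop :=
  ∃ c, HasCharacterExpansion c F ∧ ∑' χ, ‖c χ‖ ≤ C

namespace HasCharacterNormLE

variable {F F' : G → ℂ} {C C' : ℝ}

theorem norm_le (h : HasCharacterNormLE F C) (x : G) : ‖F x‖ ≤ C :=
  let ⟨_, hc, hC⟩ := h
  (hc.norm_le x).trans hC

theorem mono (h : HasCharacterNormLE F C) (hC : C ≤ C') : HasCharacterNormLE F C' :=
  let ⟨c, hc, hcC⟩ := h
  ⟨c, hc, hcC.trans hC⟩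

/-- The characters `e i` may repeat; their coefficients are then added up. -/
theorem of_family {ι : Type*} {a : ι → ℂ} {e : ι → (G →ₜ* Circle)} (ha : Summable fun i => ‖a i‖)
    (hC : ∑' i, ‖a i‖ ≤ C) (hF : ∀ x, HasSum (fun i => a i * e i x) (F x)) :
    HasCharacterNormLE F C := by
  let c : (G →ₜ* Circle) → ℂ := fun χ => ∑' i : e ⁻¹' {χ}, a i
  have hnorm := ha.hasSum.tsum_fiberwise e
  have hle : ∀ χ, ‖c χ‖ ≤ ∑' i : e ⁻¹' {χ}, ‖a i‖ := fun χ =>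
    norm_tsum_le_tsum_norm (ha.subtype _)
  have hc : Summable fun χ => ‖c χ‖ := hnorm.summable.of_nonneg_of_le (fun _ => norm_nonneg _) hle
  refine ⟨c, ⟨hc, fun x => ?_⟩, (hc.tsum_le_tsum hle hnorm.summable).trans (hnorm.tsum_eq ▸ hC)⟩
  refine ((hF x).tsum_fiberwise e).congr_fun fun χ => ?_
  rw [← tsum_mul_right]
  exact tsum_congr fun i => by rw [show e i = χ from i.2]

theorem of_character (χ : G →ₜ* Circle) : HasCharacterNormLE (fun x => (χ x : ℂ)) 1 :=
  of_family (ι := Unit) (a := fun _ => 1) (e := fun _ => χ) .of_finite (by simp) (by simp)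

theorem smul (a : ℂ) (h : HasCharacterNormLE F C) : HasCharacterNormLE (a • F) (‖a‖ * C) := by
  obtain ⟨c, hc, hC⟩ := h
  refine ⟨a • c, ⟨by simpa using hc.1.mul_left ‖a‖, fun x => ?_⟩, ?_⟩
  · simpa [mul_assoc] using (hc.2 x).mul_left a
  · simpa [tsum_mul_left] using mul_le_mul_of_nonneg_left hC (norm_nonneg a)

theorem sum {ι : Type*} {s : Finset ι} {F : ι → G → ℂ} (h : ∀ i ∈ s, HasCharacterNormLE (F i) C) :
    HasCharacterNormLE (∑ i ∈ s, F i) (s.card * C) := by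
  classical
  induction s using Finset.induction with
  | empty => exact ⟨0, ⟨by simp [summable_zero], fun x => by simp⟩, by simp⟩
  | insert i s hi ih =>
    obtain ⟨c, hc, hC⟩ := h i (Finset.mem_insert_self i s)
    obtain ⟨d, hd, hD⟩ := ih fun j hj => h j (Finset.mem_insert_of_mem hj)
    have hle : ∀ χ, ‖(c + d) χ‖ ≤ ‖c χ‖ + ‖d χ‖ := fun _ => norm_add_le _ _
    have hsum : Summable fun χ => ‖(c + d) χ‖ :=
      (hc.1.add hd.1).of_nonneg_of_le (fun _ => norm_nonneg _) hle
    refine ⟨c + d, ⟨hsum, fun x => ?_⟩, ?_⟩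
    · simpa [Finset.sum_insert hi, add_mul] using (hc.2 x).add (hd.2 x)
    · have := hsum.tsum_le_tsum hle (hc.1.add hd.1)
      rw [hc.1.tsum_add hd.1] at this
      rw [Finset.card_insert_of_notMem hi]
      push_cast
      linarith

theorem average {F : ℕ → G → ℂ} (h : ∀ n, HasCharacterNormLE (F n) C) (N : ℕ) :
    HasCharacterNormLE ((N : ℂ)⁻¹ • ∑ n ∈ Finset.range N, F n) C := by
  obtain ⟨c, hc, hC⟩ := (sum (s := Finset.range N) fun n _ => h n).smul (N : ℂ)⁻¹
  refine ⟨c, hc, hC.trans ?_⟩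
  have h0 : 0 ≤ C := (norm_nonneg _).trans ((h 0).norm_le 1)
  rcases N.eq_zero_or_pos with rfl | hN
  · simpa using h0
  · rw [Finset.card_range, norm_inv, Complex.norm_natCast,
      inv_mul_cancel_left₀ (Nat.cast_ne_zero.2 hN.ne')]

theorem star (h : HasCharacterNormLE F C) : HasCharacterNormLE (fun x => conj (F x)) C := by
  obtain ⟨c, hc, hC⟩ := h
  refine of_family (a := fun χ => conj (c χ)) (e := fun χ => χ⁻¹) (by simpa using hc.1)
    (by simpa using hC) fun x => ?_
  have hinv : ∀ χ : G →ₜ* Circle, ((χ⁻¹ x : Circle) : ℂ) = conj (χ x : ℂ) := fun χ =>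
    Circle.coe_inv_eq_conj (χ x)
  simpa [hinv] using Complex.hasSum_conj'.2 (hc.2 x)

theorem mul_right_translate (h : HasCharacterNormLE F C) (τ : G) :
    HasCharacterNormLE (fun x => F (x * τ)) C := by
  obtain ⟨c, hc, hC⟩ := h
  exact ⟨_, hc.mul_right_translate τ, by simpa only [norm_mul_character] using hC⟩

theorem mul (h : HasCharacterNormLE F C) (h' : HasCharacterNormLE F' C') :
    HasCharacterNormLE (fun x => F x * F' x) (C * C') := by
  have h0 : 0 ≤ C := (norm_nonneg _).trans (h.norm_le 1)
  obtain ⟨c, hc, hC⟩ := h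
  obtain ⟨d, hd, hD⟩ := h'
  have hs : Summable fun p : (G →ₜ* Circle) × (G →ₜ* Circle) => ‖c p.1 * d p.2‖ := by
    simpa only [norm_mul] using
      hc.1.mul_of_nonneg hd.1 (fun _ => norm_nonneg _) fun _ => norm_nonneg _
  have hle : ∑' p : (G →ₜ* Circle) × (G →ₜ* Circle), ‖c p.1 * d p.2‖ ≤ C * C' := by
    simp only [norm_mul]
    rw [← hc.1.tsum_mul_tsum hd.1 (by simpa only [norm_mul] using hs)]
    exact mul_le_mul hC hD (tsum_nonneg fun _ => norm_nonneg _) h0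
  refine of_family hs hle (e := fun p => p.1 * p.2) fun x => ?_
  have hx : Summable fun p : (G →ₜ* Circle) × (G →ₜ* Circle) =>
      (c p.1 * (p.1 x : ℂ)) * (d p.2 * (p.2 x : ℂ)) :=
    .of_norm (by simpa only [norm_mul, Circle.norm_coe, mul_one] using hs)
  have hmul : ∀ χ ψ : G →ₜ* Circle, ((χ * ψ) x : ℂ) = χ x * ψ x := fun χ ψ => by
    rw [ContinuousMonoidHom.mul_apply, Circle.coe_mul]
  simp only [hmul]
  simpa only [mul_mul_mul_comm] using (hc.2 x).mul (hd.2 x) hx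

end HasCharacterNormLE

end CharacterNorm

section BoundedPowers

theorem tendsto_integral_mul_of_norm_le {X : Type*} [MeasurableSpace X] {μ : Measure X}
    {u : ℕ → X → ℂ} {U w : X → ℂ} {C : ℝ} (hu : ∀ n, AEStronglyMeasurable (u n) μ)
    (hC : ∀ n x, ‖u n x‖ ≤ C) (hlim : ∀ x, Tendsto (fun n => u n x) atTop (𝓝 (U x)))
    (hw : Integrable w μ) :
    Tendsto (fun n => ∫ x, u n x * w x ∂μ) atTop (𝓝 (∫ x, U x * w x ∂μ)) :=
  tendsto_integral_of_dominated_convergence (fun x => C * ‖w x‖) (fun n => (hu n).mul hw.1)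
    (hw.norm.const_mul C)
    (fun n => .of_forall fun x => by rw [norm_mul]; gcongr; exact hC n x)
    (.of_forall fun x => (hlim x).mul_const (w x))

theorem ae_eq_zero_of_integral_mul_conj_eq_zero {X : Type*} [MeasurableSpace X] {μ : Measure X}
    {w : X → ℂ} (hint : Integrable (fun x => w x * conj (w x)) μ)
    (h : ∫ x, w x * conj (w x) ∂μ = 0) : w =ᵐ[μ] 0 := by
  have hsq : ∀ x, w x * conj (w x) = ((‖w x‖ ^ 2 : ℝ) : ℂ) := fun x => by
    rw [Complex.mul_conj', Complex.ofReal_pow]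
  simp only [hsq] at h hint
  rw [integral_complex_ofReal, Complex.ofReal_eq_zero,
    integral_eq_zero_iff_of_nonneg (fun _ => sq_nonneg _) hint.re] at h
  filter_upwards [h] with x hx
  simpa using hx

theorem eq_zero_or_eq_one_of_continuous_of_mul_self {X : Type*} [TopologicalSpace X]
    [PreconnectedSpace X] {g : X → ℂ} (hg : Continuous g) (h : ∀ x, g x * g x = g x) :
    (∀ x, g x = 0) ∨ ∀ x, g x = 1 := by
  have hval : ∀ x, g x = 0 ∨ g x = 1 := fun x => by
    rcases eq_or_ne (g x) 0 with h0 | h0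
    · exact .inl h0
    · exact .inr (mul_left_cancel₀ h0 (by rw [h, mul_one]))
  have hclopen : IsClopen (g ⁻¹' {0}) := by
    refine ⟨isClosed_singleton.preimage hg, ?_⟩
    rw [show g ⁻¹' {0} = (g ⁻¹' {1})ᶜ by ext x; rcases hval x with hx | hx <;> simp [hx]]
    exact (isClosed_singleton.preimage hg).isOpen_compl
  rcases isClopen_iff.1 hclopen with hs | hs
  · exact .inr fun x => (hval x).resolve_left fun hx => Set.eq_empty_iff_forall_notMem.1 hs x hx
  · exact .inl fun x => Set.eq_univ_iff_forall.1 hs x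

variable {G : Type*} [Group G] [TopologicalSpace G] [MeasurableSpace G] [OpensMeasurableSpace G]
  {μ : Measure G} [IsProbabilityMeasure μ] [MeasurableMul G] [μ.IsMulLeftInvariant]

namespace HasCharacterNormLE

variable {C : ℝ} {u : ℕ → G → ℂ} {U : G → ℂ}

theorem exists_expansion_of_tendsto (h : ∀ n, HasCharacterNormLE (u n) C)
    (hlim : ∀ x, Tendsto (fun n => u n x) atTop (𝓝 (U x))) :
    ∃ b g, HasCharacterExpansion b g ∧ ∑' χ, ‖b χ‖ ≤ C ∧
      ∀ χ, ∫ x, U x * conj (χ x : ℂ) ∂μ = b χ := by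
  have hbound : ∀ n x, ‖u n x‖ ≤ C := fun n => (h n).norm_le
  choose c hc hcC using h
  let b : (G →ₜ* Circle) → ℂ := fun χ => ∫ x, U x * conj (χ x : ℂ) ∂μ
  have hcoeff : ∀ χ, Tendsto (fun n => c n χ) atTop (𝓝 (b χ)) := fun χ => by
    simpa only [(hc _).integral_mul_conj_character] using tendsto_integral_mul_of_norm_le
      (fun n => (hc n).continuous.aestronglyMeasurable) hbound hlim
      (integrable_conj (integrable_character (μ := μ) χ))
  have hpartial : ∀ s : Finset (G →ₜ* Circle), ∑ χ ∈ s, ‖b χ‖ ≤ C := fun s =>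
    le_of_tendsto' (tendsto_finsetSum s fun χ _ => (hcoeff χ).norm) fun n =>
      ((hc n).1.sum_le_tsum s fun _ _ => norm_nonneg _).trans (hcC n)
  have hb : Summable fun χ => ‖b χ‖ := summable_of_sum_le (fun _ => norm_nonneg _) hpartial
  exact ⟨b, _, .of_summable hb, hb.tsum_le_of_sum_le hpartial, fun _ => rfl⟩

theorem exists_ae_eq_of_tendsto (h : ∀ n, HasCharacterNormLE (u n) C)
    (hlim : ∀ x, Tendsto (fun n => u n x) atTop (𝓝 (U x))) :
    ∃ g, HasCharacterNormLE g C ∧ U =ᵐ[μ] g := by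
  obtain ⟨b, g, hg, hbC, hb⟩ := exists_expansion_of_tendsto (μ := μ) h hlim
  refine ⟨g, ⟨b, hg, hbC⟩, ?_⟩
  have hbound : ∀ n x, ‖u n x‖ ≤ C := fun n => (h n).norm_le
  choose c hc _ using h
  have hmeas : ∀ n, AEStronglyMeasurable (u n) μ := fun n => (hc n).continuous.aestronglyMeasurable
  have hUC : ∀ x, ‖U x‖ ≤ C := fun x => le_of_tendsto' (hlim x).norm (hbound · x)
  have hU : Integrable U μ := .of_bound
    (aestronglyMeasurable_of_tendsto_ae atTop hmeas (.of_forall hlim)) C (.of_forall hUC)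
  have hw : Integrable (fun x => U x - g x) μ := hU.sub hg.integrable
  have horth : ∀ χ : G →ₜ* Circle, ∫ x, (U x - g x) * conj (χ x : ℂ) ∂μ = 0 := fun χ => by
    have hχ := integrable_conj (integrable_character (μ := μ) χ)
    simp only [sub_mul]
    rw [integral_sub (hχ.bdd_mul hU.1 (.of_forall hUC))
      (hχ.bdd_mul hg.integrable.1 (.of_forall hg.norm_le)), hb, hg.integral_mul_conj_character,
      sub_self]
  have hUw : ∫ x, U x * conj (U x - g x) ∂μ = 0 := by
    refine tendsto_nhds_unique
      (tendsto_integral_mul_of_norm_le hmeas hbound hlim (integrable_conj hw)) ?_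
    simp only [(hc _).integral_mul_conj_eq_zero hw horth, tendsto_const_nhds]
  have hUw_int := (integrable_conj hw).bdd_mul hU.1 (.of_forall hUC)
  have hgw_int := (integrable_conj hw).bdd_mul hg.integrable.1 (.of_forall hg.norm_le)
  refine (sub_ae_eq_zero U g).1 (ae_eq_zero_of_integral_mul_conj_eq_zero ?_ ?_)
  · simp only [Pi.sub_apply, sub_mul]
    exact hUw_int.sub hgw_int
  · simp only [Pi.sub_apply, sub_mul]
    rw [integral_sub hUw_int hgw_int, hUw, hg.integral_mul_conj_eq_zero hw horth, sub_zero]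

theorem ae_eq_const_or_forall_eq [PreconnectedSpace G] [μ.IsOpenPosMeasure] {v : G → ℂ}
    (hv : ∀ x, ‖v x‖ = 1) (hpow : ∀ n : ℕ, HasCharacterNormLE (fun x => v x ^ n) C) (z : ℂ) :
    μ (v ⁻¹' {z}) = 0 ∨ ∀ x, v x = z := by
  rcases ne_or_eq ‖z‖ 1 with hz | hz
  · left
    convert measure_empty (μ := μ)
    exact Set.eq_empty_iff_forall_notMem.2 fun x hx => hz (hx ▸ hv x)
  have hz_mul : ∀ x, conj z * v x = 1 ↔ v x = z := fun x => by
    rw [← Complex.inv_eq_conj hz, inv_mul_eq_one₀ (norm_ne_zero_iff.1 (hz ▸ one_ne_zero)), eq_comm]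
  have hrot : ∀ n : ℕ, HasCharacterNormLE (fun x => (conj z * v x) ^ n) C := fun n => by
    simpa [hz, mul_pow, Pi.smul_def] using (hpow n).smul (conj z ^ n)
  obtain ⟨g, hg, hUg⟩ := exists_ae_eq_of_tendsto (μ := μ) (fun N => average hrot N) (fun x => by
    simpa using tendsto_average_pow (z := conj z * v x) (by simp [hz, hv]))
  obtain ⟨c, hc, -⟩ := hg
  have hidem : ∀ x, g x * g x = g x := congrFun <|
    (hc.continuous.mul hc.continuous).ae_eq_iff_eq μ hc.continuous |>.1 <| by
      filter_upwards [hUg] with x hx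
      simp [← hx]
  refine (eq_zero_or_eq_one_of_continuous_of_mul_self hc.continuous hidem).imp
    (fun h0 => ?_) fun h1 => ?_
  · refine measure_mono_null (fun x (hx : v x = z) => ?_) hUg
    simp [h0, hx, hz_mul]
  · obtain ⟨d, hd, -⟩ := hpow 1
    have hvcont : Continuous v := by simpa using hd.continuous
    refine congrFun ((hvcont.ae_eq_iff_eq μ continuous_const).1 ?_)
    filter_upwards [hUg] with x hx
    by_contra hne
    simp [h1, hz_mul, hne] at hx

end HasCharacterNormLE

section BeurlingHelson

variable [PreconnectedSpace G] [μ.IsOpenPosMeasure]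

theorem ae_character_ne {χ ψ : G →ₜ* Circle} (h : χ ≠ ψ) : ∀ᵐ τ ∂μ, χ τ ≠ ψ τ := by
  have hpow : ∀ n : ℕ, HasCharacterNormLE (fun x => ((χ * ψ⁻¹) x : ℂ) ^ n) 1 := fun n => by
    simpa using HasCharacterNormLE.of_character ((χ * ψ⁻¹) ^ n)
  have hone : ∀ τ, ((χ * ψ⁻¹) τ : ℂ) = 1 ↔ χ τ = ψ τ := fun τ => by
    rw [Circle.coe_eq_one, ContinuousMonoidHom.mul_apply]
    exact mul_inv_eq_one
  rcases HasCharacterNormLE.ae_eq_const_or_forall_eq (μ := μ)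
    (fun x => Circle.norm_coe _) hpow 1 with hnull | hall
  · exact measure_mono_null (fun τ hτ => (hone τ).2 (not_not.1 hτ)) hnull
  · exact absurd (ContinuousMonoidHom.ext fun τ => (hone τ).1 (hall τ)) h

variable {c : (G →ₜ* Circle) → ℂ} {f : G → ℂ}

namespace HasCharacterExpansion

theorem measure_mul_conj_level_eq_zero (h : HasCharacterExpansion c f) (hf : ∀ x, ‖f x‖ = 1)
    (hpow : ∀ n : ℕ, HasCharacterNormLE (fun x => f x ^ n) C) {χ ψ : G →ₜ* Circle}
    (hχ : c χ ≠ 0) (hψ : c ψ ≠ 0) {τ : G} (hτ : χ τ ≠ ψ τ) (z : ℂ) :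
    μ ((fun x => f (x * τ) * conj (f x)) ⁻¹' {z}) = 0 := by
  refine (HasCharacterNormLE.ae_eq_const_or_forall_eq (C := C * C) (fun x => by simp [hf])
    (fun n => ?_) z).resolve_right fun hz => hτ ?_
  · simpa [mul_pow] using ((hpow n).mul_right_translate τ).mul (hpow n).star
  have htranslate : ∀ x, f (x * τ) = z * f x := fun x => by
    rw [← hz x, mul_assoc, Complex.conj_mul', hf]
    simp
  have hcoeff : ∀ θ, c θ ≠ 0 → (θ τ : ℂ) = z := fun θ hθ => by
    have := (h.mul_right_translate τ).integral_mul_conj_character (μ := μ) θ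
    simp only [htranslate, mul_assoc, integral_const_mul, h.integral_mul_conj_character] at this
    exact mul_left_cancel₀ hθ (by rw [← this, mul_comm])
  exact Circle.ext ((hcoeff χ hχ).trans (hcoeff ψ hψ).symm)

theorem tendsto_average_integral_norm_autocorrelation_sq (h : HasCharacterExpansion c f)
    (hf : ∀ x, ‖f x‖ = 1) (hpow : ∀ n : ℕ, HasCharacterNormLE (fun x => f x ^ n) C)
    {χ ψ : G →ₜ* Circle} (hχ : c χ ≠ 0) (hψ : c ψ ≠ 0) (hne : χ ≠ ψ) :
    Tendsto (fun N : ℕ => (N : ℝ)⁻¹ • ∑ n ∈ Finset.range N,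
      ∫ τ, ‖∫ x, f (x * τ) ^ n * conj (f x ^ n) ∂μ‖ ^ 2 ∂μ) atTop (𝓝 0) := by
  let K : ℕ → G → ℝ := fun n τ => ‖∫ x, f (x * τ) ^ n * conj (f x ^ n) ∂μ‖ ^ 2
  have hKcont : ∀ n, Continuous (K n) := fun n => by
    obtain ⟨d, hd, -⟩ := hpow n
    exact (hd.autocorrelation (μ := μ)).continuous.norm.pow 2
  have hKle : ∀ n τ, ‖K n τ‖ ≤ 1 := fun n τ => by
    rw [norm_pow, norm_norm]
    refine pow_le_one₀ (norm_nonneg _) ?_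
    simpa using norm_integral_le_of_norm_le_const (μ := μ) (C := 1)
      (f := fun x => f (x * τ) ^ n * conj (f x ^ n)) (.of_forall fun x => by simp [hf])
  have hKint : ∀ n, Integrable (K n) μ := fun n =>
    .of_bound (hKcont n).aestronglyMeasurable 1 (.of_forall (hKle n))
  have hlim : ∀ᵐ τ ∂μ, Tendsto (fun N : ℕ => (N : ℝ)⁻¹ • ∑ n ∈ Finset.range N, K n τ) atTop
      (𝓝 0) := by
    filter_upwards [ae_character_ne hne] with τ hτ
    have hcont : Continuous fun x => f (x * τ) * conj (f x) :=
      (h.mul_right_translate τ).continuous.mul (Complex.continuous_conj.comp h.continuous)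
    simpa only [K, mul_pow, map_pow] using tendsto_average_norm_integral_pow_sq hcont.measurable
      (fun x => by simp [hf]) (h.measure_mul_conj_level_eq_zero hf hpow hχ hψ hτ)
  have hint : Tendsto (fun N : ℕ => ∫ τ, (N : ℝ)⁻¹ • ∑ n ∈ Finset.range N, K n τ ∂μ) atTop
      (𝓝 (∫ _, 0 ∂μ)) :=
    tendsto_integral_of_dominated_convergence (fun _ => 1)
      (fun N => (continuous_finsetSum _ fun n _ => hKcont n).const_smul (N : ℝ)⁻¹
        |>.aestronglyMeasurable) (integrable_const 1)
      (fun N => .of_forall fun τ => norm_average_le zero_le_one (hKle · τ) N) hlim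
  simp only [integral_smul, integral_finsetSum _ fun n _ => hKint n, integral_zero] at hint
  exact hint

end HasCharacterExpansion

end BeurlingHelson

end BoundedPowers

/-- The Beurling–Helson theorem. -/
theorem HasCharacterExpansion.eq_of_bounded_powers {G : Type*} [Group G] [TopologicalSpace G]
    [IsTopologicalGroup G] [CompactSpace G] [PreconnectedSpace G] {c : (G →ₜ* Circle) → ℂ}
    {f : G → ℂ} {C : ℝ} (h : HasCharacterExpansion c f) (hf : ∀ x, ‖f x‖ = 1)
    (hpow : ∀ n : ℕ, HasCharacterNormLE (fun x => f x ^ n) C) {χ ψ : G →ₜ* Circle}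
    (hχ : c χ ≠ 0) (hψ : c ψ ≠ 0) : χ = ψ := by
  by_contra hne
  let _ : MeasurableSpace G := borel G
  have _ : BorelSpace G := ⟨rfl⟩
  let μ : Measure G := Measure.haarMeasure ⊤
  have _ : IsProbabilityMeasure μ := ⟨Measure.haarMeasure_self⟩
  have hlower : ∀ n : ℕ,
      1 ≤ C ^ 2 * ∫ τ, ‖∫ x, f (x * τ) ^ n * conj (f x ^ n) ∂μ‖ ^ 2 ∂μ := fun n => by
    obtain ⟨d, hd, hdC⟩ := hpow n
    exact hd.one_le_mul_integral_norm_autocorrelation_sq (by simp [hf]) hdC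
  have hlim := (h.tendsto_average_integral_norm_autocorrelation_sq (μ := μ) hf hpow hχ hψ
    hne).const_mul (C ^ 2)
  rw [mul_zero] at hlim
  refine absurd (ge_of_tendsto hlim ?_) (not_le.2 one_pos)
  filter_upwards [eventually_gt_atTop 0] with N hN
  rw [smul_eq_mul, mul_left_comm, Finset.mul_sum, le_inv_mul_iff₀ (Nat.cast_pos.2 hN), mul_one]
  simpa using Finset.card_nsmul_le_sum (Finset.range N) _ 1 fun n _ => hlower n

section InfiniteTorus

open HasWienerExpansion

theorem torusPoint_mem_infiniteTorus (w : ℕ → Circle) : torusPoint w ∈ infiniteTorus := fun j =>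
  Circle.norm_coe (w j)

/-- The restriction of the monomial `z^α` to the torus, as a character of the compact group
`Circle^ℕ`. -/
def monomialCharacter (α : ℕ →₀ ℕ) : (ℕ → Circle) →ₜ* Circle where
  toFun w := ⟨polyMonomial α (torusPoint w),
    mem_sphere_zero_iff_norm.2 (norm_polyMonomial_point α w)⟩
  map_one' := Circle.ext (by simp [polyMonomial, torusPoint])
  map_mul' v w := Circle.ext (polyMonomial_mul_point α v w)
  continuous_toFun := (continuous_polyMonomial_point α).subtype_mk _

theorem coe_monomialCharacter (α : ℕ →₀ ℕ) (w : ℕ → Circle) :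
    (monomialCharacter α w : ℂ) = polyMonomial α (torusPoint w) := rfl

theorem monomialCharacter_injective : Function.Injective monomialCharacter := fun α β h => by
  by_contra hne
  obtain ⟨w, hw⟩ := exists_point_ne hne
  exact hw (congrArg (fun χ : (ℕ → Circle) →ₜ* Circle => (χ w : ℂ)) h)

theorem HasWienerExpansion.hasCharacterExpansion {a : (ℕ →₀ ℕ) → ℂ} {f : ClosedPolydisc → ℂ}
    (h : HasWienerExpansion a f) :
    HasCharacterExpansion (Function.extend monomialCharacter a 0) (f ∘ torusPoint) := by
  refine ⟨?_, fun w => ?_⟩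
  · refine (monomialCharacter_injective.summable_iff fun χ hχ => ?_).1 ?_
    · simp [Function.extend_apply' _ _ _ hχ]
    · simpa [Function.comp_def, monomialCharacter_injective.extend_apply] using h.1
  · refine (monomialCharacter_injective.hasSum_iff fun χ hχ => ?_).1 ?_
    · simp [Function.extend_apply' _ _ _ hχ]
    · simpa [Function.comp_def, monomialCharacter_injective.extend_apply,
        coe_monomialCharacter] using h.2 (torusPoint w)

theorem WienerAlgebra.hasCharacterNormLE (f : WienerAlgebra) :
    HasCharacterNormLE (f.toFun ∘ torusPoint) ‖f‖ :=
  .of_family (e := monomialCharacter) f.hasWienerExpansion.1 f.norm_def.ge fun w =>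
    f.hasWienerExpansion.2 (torusPoint w)

theorem exists_eq_monomial_of_bounded_powers {f : WienerAlgebra} {F : ℕ → WienerAlgebra} {C : ℝ}
    (hF : ∀ n z, (F n).toFun z = f.toFun z ^ n) (hC : ∀ n, ‖F n‖ ≤ C)
    (h1 : ∀ z ∈ infiniteTorus, ‖f.toFun z‖ = 1) :
    ∃ (α : ℕ →₀ ℕ) (c : ℂ), ‖c‖ = 1 ∧ ∀ z, f.toFun z = c * polyMonomial α z := by
  have hf := f.hasWienerExpansion
  have hunimod : ∀ w, ‖f.toFun (torusPoint w)‖ = 1 := fun w =>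
    h1 _ (torusPoint_mem_infiniteTorus w)
  have hpow : ∀ n : ℕ, HasCharacterNormLE (fun w => f.toFun (torusPoint w) ^ n) C := fun n => by
    simpa only [Function.comp_def, hF] using (F n).hasCharacterNormLE.mono (hC n)
  have hsubsingleton : ∀ α β, f.coeff α ≠ 0 → f.coeff β ≠ 0 → α = β := fun α β hα hβ =>
    monomialCharacter_injective <| hf.hasCharacterExpansion.eq_of_bounded_powers hunimod hpow
      (by rwa [monomialCharacter_injective.extend_apply])
      (by rwa [monomialCharacter_injective.extend_apply])
  obtain ⟨α, hα⟩ : ∃ α, f.coeff α ≠ 0 := by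
    by_contra! h0
    have hzero := (hf.2 (torusPoint 1)).tsum_eq
    simp only [h0, zero_mul, tsum_zero] at hzero
    simpa [← hzero] using hunimod 1
  have hmon : ∀ z, f.toFun z = f.coeff α * polyMonomial α z := fun z =>
    (hf.2 z).unique <| hasSum_single α fun β hβ => by
      rw [not_not.1 fun h => hβ (hsubsingleton β α h hα), zero_mul]
  refine ⟨α, f.coeff α, ?_, hmon⟩
  simpa [hmon, norm_polyMonomial_point] using hunimod 1

end InfiniteTorus

theorem HasWienerExpansion.of_summable {a : (ℕ →₀ ℕ) → ℂ} (ha : Summable fun α => ‖a α‖) :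
    HasWienerExpansion a fun z => ∑' α, a α * polyMonomial α z :=
  ⟨ha, fun z => (Summable.of_norm_bounded ha fun α => by
    rw [norm_mul]
    exact mul_le_of_le_one_right (norm_nonneg _) (norm_polyMonomial_le α z)).hasSum⟩

namespace WienerAlgebra

theorem ext_toFun {f g : WienerAlgebra} (h : ∀ z, f.toFun z = g.toFun z) : f = g :=
  Subtype.ext (funext h)

theorem norm_toFun_le (f : WienerAlgebra) (z : ClosedPolydisc) : ‖f.toFun z‖ ≤ ‖f‖ := by
  have hf := f.hasWienerExpansion
  rw [← (hf.2 z).tsum_eq]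
  exact tsum_of_norm_bounded hf.1.hasSum fun α => by
    rw [norm_mul]; exact mul_le_of_le_one_right (norm_nonneg _) (norm_polyMonomial_le α z)

theorem toFun_smul (c : ℂ) (f : WienerAlgebra) (z : ClosedPolydisc) :
    (c • f).toFun z = c * f.toFun z := rfl

/-- The element `∑_α a_α z^α` of the Wiener algebra with prescribed Taylor coefficients. -/
def ofCoeff (a : (ℕ →₀ ℕ) → ℂ) (ha : Summable fun α => ‖a α‖) : WienerAlgebra :=
  ⟨fun z => ∑' α, a α * polyMonomial α z, a, .of_summable ha⟩

theorem coeff_ofCoeff (a : (ℕ →₀ ℕ) → ℂ) (ha : Summable fun α => ‖a α‖) :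
    (ofCoeff a ha).coeff = a :=
  coeff_eq _ (.of_summable ha)

/-- The map from the Wiener algebra to `ℓ¹` taking Taylor coefficients. -/
def coeffLp : WienerAlgebra →ₗᵢ[ℂ] lp (fun _ : ℕ →₀ ℕ => ℂ) 1 where
  toFun f := ⟨f.coeff, memℓp_gen (by simpa using f.hasWienerExpansion.1)⟩
  map_add' f g := Subtype.ext (coeff_add f g)
  map_smul' c f := Subtype.ext (coeff_smul c f)
  norm_map' f := by
    rw [lp.norm_eq_tsum_rpow (by simp)]
    simp [norm_def]

theorem coeffLp_surjective : Function.Surjective coeffLp := fun a =>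
  ⟨ofCoeff a (by simpa using (lp.memℓp a).summable (by simp)), Subtype.ext (coeff_ofCoeff _ _)⟩

instance : CompleteSpace WienerAlgebra := by
  refine coeffLp.isometry.isUniformInducing.completeSpace ?_
  rw [coeffLp_surjective.range_eq]
  exact isComplete_univ

/-- The monomial `z^β` as an element of the Wiener algebra. -/
def monomial (β : ℕ →₀ ℕ) : WienerAlgebra :=
  ofCoeff (Pi.single β 1) (summable_of_ne_finset_zero (s := {β}) fun α hα => by simp_all)

theorem coeff_monomial (β : ℕ →₀ ℕ) : (monomial β).coeff = Pi.single β 1 := coeff_ofCoeff _ _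

theorem toFun_monomial (β : ℕ →₀ ℕ) (z : ClosedPolydisc) :
    (monomial β).toFun z = polyMonomial β z := by
  change ∑' α, (Pi.single β 1 : (ℕ →₀ ℕ) → ℂ) α * polyMonomial α z = _
  rw [tsum_eq_single β fun α hα => by simp [hα]]
  simp

theorem norm_monomial (β : ℕ →₀ ℕ) : ‖monomial β‖ = 1 := by
  rw [norm_def, coeff_monomial, tsum_eq_single β fun α hα => by simp [hα]]
  simp

end WienerAlgebra

open WienerAlgebra

theorem continuous_compositionOperator (φ : ClosedPolydisc → ClosedPolydisc)
    (hφ : InducesCompositionOperator φ) : Continuous (compositionOperator φ hφ) := by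
  refine LinearMap.continuous_of_seq_closed_graph _ fun u f g hu hg => ext_toFun fun z => ?_
  have heval : ∀ (v : ℕ → WienerAlgebra) (h : WienerAlgebra) (x : ClosedPolydisc),
      Tendsto v atTop (𝓝 h) → Tendsto (fun n => (v n).toFun x) atTop (𝓝 (h.toFun x)) := by
    intro v h x hv
    rw [tendsto_iff_norm_sub_tendsto_zero] at hv ⊢
    exact squeeze_zero (fun _ => norm_nonneg _) (fun n => norm_toFun_le (v n - h) x) hv
  exact tendsto_nhds_unique (heval _ g z hg) (heval _ f (φ z) hu)

theorem exists_norm_compositionOperator_le (φ : ClosedPolydisc → ClosedPolydisc)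
    (hφ : InducesCompositionOperator φ) : ∃ C, ∀ f, ‖compositionOperator φ hφ f‖ ≤ C * ‖f‖ :=
  let T : WienerAlgebra →L[ℂ] WienerAlgebra :=
    ⟨compositionOperator φ hφ, continuous_compositionOperator φ hφ⟩
  ⟨‖T‖, T.le_opNorm⟩

theorem polyMonomial_single (i n : ℕ) (z : ClosedPolydisc) :
    polyMonomial (Finsupp.single i n) z = (z i : ℂ) ^ n := by
  simp [polyMonomial]

theorem polyMonomial_nsmul (n : ℕ) (α : ℕ →₀ ℕ) (z : ClosedPolydisc) :
    polyMonomial (n • α) z = polyMonomial α z ^ n := by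
  induction n with
  | zero => simp [polyMonomial]
  | succ n ih => rw [succ_nsmul, polyMonomial_add, ih, pow_succ]

theorem exists_hasMonomialForm (φ : ClosedPolydisc → ClosedPolydisc)
    (hφ : InducesCompositionOperator φ) (hT : ∀ z ∈ infiniteTorus, φ z ∈ infiniteTorus) :
    ∃ (A : ℕ → ℕ →₀ ℕ) (ε : ℕ → ℂ), HasMonomialForm φ A ε := by
  obtain ⟨C, hC⟩ := exists_norm_compositionOperator_le φ hφ
  have hpow : ∀ i n z, (compositionOperator φ hφ (monomial (Finsupp.single i n))).toFun z
      = (φ z i : ℂ) ^ n := fun i n z => by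
    rw [compositionOperator_toFun, toFun_monomial, polyMonomial_single]
  have hmonomial :
      ∀ i, ∃ (α : ℕ →₀ ℕ) (c : ℂ), ‖c‖ = 1 ∧ ∀ z, (φ z i : ℂ) = c * polyMonomial α z := by
    intro i
    have hone : ∀ z, (compositionOperator φ hφ (monomial (Finsupp.single i 1))).toFun z
        = (φ z i : ℂ) := fun z => by rw [hpow, pow_one]
    have := exists_eq_monomial_of_bounded_powers
      (f := compositionOperator φ hφ (monomial (Finsupp.single i 1)))
      (F := fun n => compositionOperator φ hφ (monomial (Finsupp.single i n))) (C := C)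
      (fun n z => by rw [hpow, hone])
      (fun n => (hC _).trans (by rw [norm_monomial, mul_one]))
      (fun z hz => by rw [hone]; exact hT z hz i)
    simpa only [hone] using this
  choose A ε hε hA using hmonomial
  exact ⟨A, ε, hε, fun z i => hA i z⟩

/-- The transpose of a row-finite matrix acting on finitely supported sequences of nonnegative
integers. -/
def transposeActionNat (A : ℕ → ℕ →₀ ℕ) (α : ℕ →₀ ℕ) : ℕ →₀ ℕ := α.sum fun i n => n • A i

/-- The coordinatewise inclusion of `ℕ` in `ℤ` on finitely supported sequences. -/
def natToInt : (ℕ →₀ ℕ) →+ (ℕ →₀ ℤ) := Finsupp.mapRange.addMonoidHom (Nat.castAddMonoidHom ℤ)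

theorem natToInt_apply (α : ℕ →₀ ℕ) (i : ℕ) : natToInt α i = (α i : ℤ) := rfl

theorem natToInt_injective : Function.Injective natToInt := fun α β h => by
  ext i
  exact Int.ofNat_inj.1 (DFunLike.congr_fun h i)

section Transpose

variable (A : ℕ → ℕ →₀ ℕ)

theorem transposeActionNat_add (α β : ℕ →₀ ℕ) :
    transposeActionNat A (α + β) = transposeActionNat A α + transposeActionNat A β :=
  Finsupp.sum_add_index' (fun _ => zero_smul _ _) fun _ _ _ => add_smul _ _ _

theorem transposeAction_add (α β : ℕ →₀ ℤ) :
    transposeAction A (α + β) = transposeAction A α + transposeAction A β :=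
  Finsupp.sum_add_index' (fun _ => zero_smul _ _) fun _ _ _ => add_smul _ _ _

theorem transposeAction_natToInt (α : ℕ →₀ ℕ) :
    transposeAction A (natToInt α) = natToInt (transposeActionNat A α) := by
  rw [transposeActionNat, Finsupp.sum, map_sum]
  simp only [map_nsmul]
  have : transposeAction A (natToInt α) = α.sum fun i n => (n : ℤ) • natToInt (A i) :=
    Finsupp.sum_mapRange_index (hf := map_zero _) fun _ => zero_smul _ _
  rw [this, Finsupp.sum]
  simp only [natCast_zsmul]

theorem exists_add_natToInt_eq (α : ℕ →₀ ℤ) : ∃ p q, α + natToInt q = natToInt p := by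
  refine ⟨α.mapRange Int.toNat rfl, (-α).mapRange Int.toNat rfl, ?_⟩
  ext i
  simp only [Finsupp.add_apply, natToInt_apply, Finsupp.mapRange_apply, Finsupp.neg_apply]
  omega

theorem transposeAction_injective_iff :
    Function.Injective (transposeAction A) ↔ Function.Injective (transposeActionNat A) := by
  constructor
  · intro h α β hαβ
    apply natToInt_injective
    apply h
    rw [transposeAction_natToInt, transposeAction_natToInt, hαβ]
  · intro h α β hαβ
    obtain ⟨p, q, hpq⟩ := exists_add_natToInt_eq α
    obtain ⟨r, s, hrs⟩ := exists_add_natToInt_eq β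
    have hsum : p + s = r + q := by
      apply h
      apply natToInt_injective
      simp only [← transposeAction_natToInt, map_add, transposeAction_add, ← hpq, ← hrs, hαβ]
      abel
    have hcast := congrArg natToInt hsum
    rw [map_add, map_add, ← hpq, ← hrs] at hcast
    have hadd : α + (natToInt q + natToInt s) = β + (natToInt q + natToInt s) := by
      rw [← add_assoc, hcast]; abel
    exact add_right_cancel hadd

end Transpose

section MonomialForm

variable {φ : ClosedPolydisc → ClosedPolydisc} {A : ℕ → ℕ →₀ ℕ} {ε : ℕ → ℂ}

theorem polyMonomial_comp (h : HasMonomialForm φ A ε) (α : ℕ →₀ ℕ) (z : ClosedPolydisc) :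
    polyMonomial α (φ z)
      = (α.prod fun i n => ε i ^ n) * polyMonomial (transposeActionNat A α) z := by
  induction α using Finsupp.induction_linear with
  | zero => simp [polyMonomial, transposeActionNat]
  | add α β hα hβ =>
    rw [polyMonomial_add, hα, hβ, transposeActionNat_add, polyMonomial_add,
      Finsupp.prod_add_index' (fun _ => pow_zero _) fun _ _ _ => pow_add _ _ _]
    ring
  | single i n =>
    rw [polyMonomial_single, h.2 z i, mul_pow,
      Finsupp.prod_single_index (h := fun i n => ε i ^ n) (pow_zero _), transposeActionNat,
      Finsupp.sum_single_index (h := fun i n => n • A i) (zero_smul _ _), polyMonomial_nsmul]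
    rfl

theorem norm_prod_pow_eq_one (h : HasMonomialForm φ A ε) (α : ℕ →₀ ℕ) :
    ‖α.prod fun i n => ε i ^ n‖ = 1 := by
  simp [Finsupp.prod, norm_prod, h.1]

theorem norm_compositionOperator_of_injective (h : HasMonomialForm φ A ε)
    (hφ : InducesCompositionOperator φ) (hA : Function.Injective (transposeActionNat A))
    (f : WienerAlgebra) : ‖compositionOperator φ hφ f‖ = ‖f‖ := by
  have hf := f.hasWienerExpansion
  set b : (ℕ →₀ ℕ) → ℂ := Function.extend (transposeActionNat A)
    (fun α => f.coeff α * α.prod fun i n => ε i ^ n) 0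
  have hb : ∀ α, b (transposeActionNat A α) = f.coeff α * α.prod fun i n => ε i ^ n := fun α =>
    hA.extend_apply _ _ _
  have hb0 : ∀ β, β ∉ Set.range (transposeActionNat A) → b β = 0 := fun β hβ =>
    Function.extend_apply' _ _ _ hβ
  have hnb : ∀ α, ‖b (transposeActionNat A α)‖ = ‖f.coeff α‖ := fun α => by
    rw [hb, norm_mul, norm_prod_pow_eq_one h, mul_one]
  have hn : HasSum (fun β => ‖b β‖) ‖f‖ := by
    rw [← hA.hasSum_iff fun β hβ => by rw [hb0 β hβ, norm_zero]]
    simp only [Function.comp_def, hnb]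
    exact hf.1.hasSum
  have hexp : HasWienerExpansion b (compositionOperator φ hφ f).toFun := by
    refine ⟨hn.summable, fun z => ?_⟩
    rw [← hA.hasSum_iff fun β hβ => by rw [hb0 β hβ, zero_mul]]
    simp only [Function.comp_def, hb, compositionOperator_toFun]
    refine (hf.2 (φ z)).congr_fun fun α => ?_
    rw [polyMonomial_comp h, mul_assoc]
  rw [norm_def, coeff_eq _ hexp, hn.tsum_eq]

theorem transposeActionNat_injective (h : HasMonomialForm φ A ε)
    (hφ : InducesCompositionOperator φ)
    (hinj : Function.Injective (compositionOperator φ hφ)) :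
    Function.Injective (transposeActionNat A) := by
  intro α β hαβ
  have hne : ∀ γ : ℕ →₀ ℕ, (γ.prod fun i n => ε i ^ n) ≠ 0 := fun γ h0 => by
    have := norm_prod_pow_eq_one h γ
    simp [h0] at this
  have heq : (β.prod fun i n => ε i ^ n) • monomial α
      = (α.prod fun i n => ε i ^ n) • monomial β := by
    apply hinj
    refine ext_toFun fun z => ?_
    simp only [compositionOperator_toFun, toFun_smul, toFun_monomial, polyMonomial_comp h, hαβ]
    ring
  by_contra hcon
  have hc := congrFun (congrArg coeff heq) α
  simp only [coeff_smul, coeff_monomial, Pi.smul_apply, Pi.single_eq_same,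
    Pi.single_eq_of_ne hcon, smul_eq_mul, mul_one, mul_zero] at hc
  exact hne β hc

theorem isometry_compositionOperator_iff (h : HasMonomialForm φ A ε)
    (hφ : InducesCompositionOperator φ) :
    Isometry (compositionOperator φ hφ) ↔ Function.Injective (transposeAction A) := by
  rw [transposeAction_injective_iff]
  exact ⟨fun hi => transposeActionNat_injective h hφ hi.injective, fun hA =>
    AddMonoidHomClass.isometry_of_norm _ (norm_compositionOperator_of_injective h hφ hA)⟩

end MonomialForm

end

theorem theorem4p4 (φ : ClosedPolydisc → ClosedPolydisc)
    (hφ : InducesCompositionOperator φ)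
    (hT : ∀ z ∈ infiniteTorus, φ z ∈ infiniteTorus) :
    (∃ (A : ℕ → ℕ →₀ ℕ) (ε : ℕ → ℂ), HasMonomialForm φ A ε) ∧
      ∀ (A : ℕ → ℕ →₀ ℕ) (ε : ℕ → ℂ), HasMonomialForm φ A ε →
        (Isometry (compositionOperator φ hφ) ↔ Function.Injective (transposeAction A)) :=
  ⟨exists_hasMonomialForm φ hφ hT, fun _ _ h => isometry_compositionOperator_iff h hφ⟩
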